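/- Let $k\ge 0$ and $\ell\ge 1$ be integers with $\ell$ odd, let $\alpha, A\ge 0$ and $\beta_2,\beta_4,\dots,\beta_{2k}\ge 0$ be real numbers, and consider the difference equation $$x_n=\frac{\alpha+\sum_{i=1}^{k}\beta_{2i}x_{n-2i}+x_{n-\ell}}{A+x_{n-\ell}},\qquad n\in\mathbb{N},$$ with positive initial conditions. Let $I_\beta=\{2i : 1\le i\le k,\ \beta_{2i}>0\}\cup\{\ell\}$ be the set of all delays that occur in the numerator with a positive coefficient (the coefficient of $x_{n-\ell}$ is $1$, so $\ell\in I_\beta$), and let $g=\gcd(I_\beta)$. Then: (i) if $A+1>\sum_{i=1}^k\beta_{2i}$, every solution with positive initial conditions converges to an equilibrium, that is, to some $c\ge 0$ with $A+c>0$ and $c=\bigl(\alpha+\sum_{i=1}^k\beta_{2i}c+c\bigr)/(A+c)$; (ii) if $A+1=\sum_{i=1}^k\beta_{2i}$, every solution $(x_n)$ with positive initial conditions converges to a periodic solution of not necessarily prime period $2g$ (there is a solution $(y_n)$ with positive initial conditions, with $y_{n+2g}=y_n$ for all $n$ and $x_n-y_n\to 0$), and there exist solutions with positive initial conditions that are periodic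 of prime (least) period $2g$; (iii) if $A+1<\sum_{i=1}^k\beta_{2i}$, there exist positive initial conditions for which the solution is unbounded. -/

import Mathlib

open Filter Topology

/-- The right-hand side of the difference equation
`x_n = (α + ∑_{i=1}^k β_{2i} x_{n-2i} + x_{n-ℓ}) / (A + x_{n-ℓ})`;
only the values of `β` at `2, 4, …, 2k` are used. -/
noncomputable def ratStep (k ℓ : ℕ) (α A : ℝ) (β : ℕ → ℝ) (x : ℕ → ℝ) (n : ℕ) : ℝ :=
  (α + ∑ i ∈ Finset.Icc 1 k, β (2 * i) * x (n - 2 * i) + x (n - ℓ)) / (A + x (n - ℓ))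

/-- `x` is a solution with positive initial conditions. Time is shifted so that the initial
conditions are `x 0, …, x (K - 1)`, where `K = max (2 * k) ℓ` is the largest delay; the equation
holds from time `K` on, so that no subtraction of indices is truncated. -/
def IsPositiveSolution (k ℓ : ℕ) (α A : ℝ) (β : ℕ → ℝ) (x : ℕ → ℝ) : Prop :=
  (∀ n, n < max (2 * k) ℓ → 0 < x n) ∧
    ∀ n, max (2 * k) ℓ ≤ n → x n = ratStep k ℓ α A β x n

/-- `c` is a (nonnegative) equilibrium, with nonvanishing denominator. -/
def IsEquilibrium (k ℓ : ℕ) (α A : ℝ) (β : ℕ → ℝ) (c : ℝ) : Prop :=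
  0 ≤ c ∧ 0 < A + c ∧ ∀ n, c = ratStep k ℓ α A β (fun _ => c) n

/-- The set of delays that occur in the numerator with a positive coefficient. The delay `ℓ`
occurs with coefficient `1`, hence always belongs to it. -/
noncomputable def numeratorDelays (k ℓ : ℕ) (β : ℕ → ℝ) : Finset ℕ :=
  insert ℓ (((Finset.Icc 1 k).filter (fun i => 0 < β (2 * i))).image (fun i => 2 * i))

/-- The greatest common divisor of the delays in the numerator. -/
noncomputable def delayGcd (k ℓ : ℕ) (β : ℕ → ℝ) : ℕ :=
  (numeratorDelays k ℓ β).gcd id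

/-- `p` is the prime (that is, least positive) period of the sequence `x`. -/
def HasPrimePeriod (x : ℕ → ℝ) (p : ℕ) : Prop :=
  0 < p ∧ Function.Periodic x p ∧ ∀ q, 0 < q → Function.Periodic x q → p ≤ q

/-!
Write `B` for the sum of the coefficients `β (2 * i)`. For large times the equation reads
`x n = 1 + (α - A + ∑ β (2 * i) * x (n - 2 * i)) / (A + x (n - ℓ))`: it increases in the terms of even
delay and, where the numerator is nonnegative, decreases in the term of odd delay. A common first
step is that a solution is eventually at least `θ` for each `θ ∈ (0, 1]` with `A + θ < B + 1`
(`IsPositiveSolution.eventually_ge`).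

*Subcritical case* `B < A + 1`. The lower bound makes `B / (A + x (n - ℓ))` a contraction factor, so
solutions are bounded. Passing to the limit in the recursion gives an upper bound for the upper
limit `S` and a lower bound for the lower limit `I`, with the term of delay `ℓ` placed at `I` or at
`S` depending on the signs of the numerators. In each of the four combinations these inequalities
force `S = I` (`eq_of_limit_bounds`).

*Critical case* `B = A + 1`. Eventually `u n = x n - 1` is positive and
`u n * (B + u (n - ℓ)) = γ + ∑ β (2 * i) * u (n - 2 * i)` with `γ = α + 1`. Put `v n = u n` for even
`n` and `v n = γ / u n` for odd `n`. In terms of `v` every step is a weighted mean of the delayed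
values, with weights bounded below (`exists_weights_parityTwist`). If terms of `v` approach its
upper limit along a residue class modulo the gcd `g` of the delays, so do the delayed terms, hence
all terms displaced by sums of delays. These sums exhaust the large multiples of `g`, so that whole
windows of the class approach the upper limit, and since means stay above the minimum of a window,
`v` converges along the class (`exists_tendsto_residue_of_mean`). Conversely every `g`-periodic
positive `v` comes from a solution of period `2 * g`, because `g` is odd
(`isPositiveSolution_one_add_parityTwist`).

*Supercritical case* `B > A + 1`. Monotonicity preserves a configuration with large terms at even
times and terms at most `1 + δ` at odd times, and the large terms grow by the factor
`B / (A + 1 + δ) > 1` over each window (`exists_unbounded_solution`).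
-/

/-! ### Induction over a sliding window -/

/-- A property that holds on a window of length `K`, the largest delay, and is passed on from the
delayed indices to the current one, holds ever after. -/
lemma window_induction {K N : ℕ} {P : ℕ → Prop} (h0 : ∀ n, N ≤ n → n < N + K → P n)
    (hs : ∀ n, N + K ≤ n → (∀ d, 0 < d → d ≤ K → P (n - d)) → P n) : ∀ n, N ≤ n → P n := by
  intro n
  induction n using Nat.strong_induction_on with
  | _ n ih =>
    intro hn
    by_cases h : n < N + K
    · exact h0 n hn h
    · exact hs n (by omega) fun d hd hdK => ih (n - d) (by omega) (by omega)

/-- The variant in which each further window of length `K` raises a level `j`; it yields geometric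
growth. -/
lemma window_induction_levels {K : ℕ} {P : ℕ → ℕ → Prop} (h0 : ∀ n, P 0 n)
    (hs : ∀ j n, K ≤ n → (∀ d, 0 < d → d ≤ K → P j (n - d)) → P (j + 1) n) :
    ∀ j n, j * K ≤ n → P j n := by
  intro j
  induction j with
  | zero => exact fun n _ => h0 n
  | succ j ih =>
    intro n hn
    rw [Nat.succ_mul] at hn
    exact hs j n (by omega) fun d hd hdK => ih (n - d) (by omega)

lemma exists_pos_le_of_lt (f : ℕ → ℝ) (a N : ℕ) (h : ∀ n, a ≤ n → n < N → 0 < f n) :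
    ∃ m, 0 < m ∧ ∀ n, a ≤ n → n < N → m ≤ f n := by
  induction N with
  | zero => exact ⟨1, one_pos, fun n _ hn => absurd hn (Nat.not_lt_zero n)⟩
  | succ N ih =>
    obtain ⟨m, hm, hle⟩ := ih fun n h1 h2 => h n h1 (by omega)
    by_cases haN : a ≤ N
    · refine ⟨min m (f N), lt_min hm (h N haN (by omega)), fun n h1 h2 => ?_⟩
      rcases Nat.lt_succ_iff_lt_or_eq.mp h2 with h3 | rfl
      · exact (min_le_left _ _).trans (hle n h1 h3)
      · exact min_le_right _ _
    · exact ⟨m, hm, fun n h1 h2 => by omega⟩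

lemma exists_ge_of_lt (f : ℕ → ℝ) (N : ℕ) : ∃ M, ∀ n, n < N → f n ≤ M := by
  obtain ⟨M, hM⟩ := ((Set.finite_Iio N).image f).bddAbove
  exact ⟨M, fun n hn => hM ⟨n, hn, rfl⟩⟩

/-! ### Elementary properties of positive solutions -/

section Basic

variable {k ℓ : ℕ} {α A : ℝ} {β : ℕ → ℝ} {x : ℕ → ℝ}

lemma two_mul_pos_le (l : ℕ) {i : ℕ} (hi : i ∈ Finset.Icc 1 k) :
    0 < 2 * i ∧ 2 * i ≤ max (2 * k) l := by
  rw [Finset.mem_Icc] at hi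
  exact ⟨by omega, le_max_of_le_left (by omega)⟩

lemma even_sub_odd_iff {n : ℕ} (hℓ : Odd ℓ) (hn : ℓ ≤ n) : Even (n - ℓ) ↔ ¬ Even n := by
  have := Nat.not_even_iff_odd.2 hℓ
  rw [Nat.even_sub hn]
  tauto

lemma even_sub_two_mul_iff {n i : ℕ} (hn : 2 * i ≤ n) : Even (n - 2 * i) ↔ Even n := by
  rw [Nat.even_sub hn]
  simp

lemma sum_mul_le (hβ : ∀ i ∈ Finset.Icc 1 k, 0 ≤ β (2 * i)) {n : ℕ} {M : ℝ}
    (h : ∀ i ∈ Finset.Icc 1 k, x (n - 2 * i) ≤ M) :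
    ∑ i ∈ Finset.Icc 1 k, β (2 * i) * x (n - 2 * i) ≤ (∑ i ∈ Finset.Icc 1 k, β (2 * i)) * M := by
  rw [Finset.sum_mul]
  exact Finset.sum_le_sum fun i hi => mul_le_mul_of_nonneg_left (h i hi) (hβ i hi)

lemma le_sum_mul (hβ : ∀ i ∈ Finset.Icc 1 k, 0 ≤ β (2 * i)) {n : ℕ} {m : ℝ}
    (h : ∀ i ∈ Finset.Icc 1 k, m ≤ x (n - 2 * i)) :
    (∑ i ∈ Finset.Icc 1 k, β (2 * i)) * m ≤ ∑ i ∈ Finset.Icc 1 k, β (2 * i) * x (n - 2 * i) := by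
  rw [Finset.sum_mul]
  exact Finset.sum_le_sum fun i hi => mul_le_mul_of_nonneg_left (h i hi) (hβ i hi)

lemma IsPositiveSolution.pos (hℓ : 0 < ℓ) (hα : 0 ≤ α) (hA : 0 ≤ A)
    (hβ : ∀ i ∈ Finset.Icc 1 k, 0 ≤ β (2 * i)) (hx : IsPositiveSolution k ℓ α A β x) (n : ℕ) :
    0 < x n := by
  refine window_induction (K := max (2 * k) ℓ) (N := 0) (P := fun n => 0 < x n)
    (fun n _ hn => hx.1 n (by simpa using hn)) (fun n hn ih => ?_) n (Nat.zero_le n)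
  rw [hx.2 n (by simpa using hn), ratStep]
  have h1 := ih ℓ hℓ (le_max_right _ _)
  have h2 : 0 ≤ ∑ i ∈ Finset.Icc 1 k, β (2 * i) * x (n - 2 * i) :=
    Finset.sum_nonneg fun i hi =>
      mul_nonneg (hβ i hi) (ih _ (two_mul_pos_le ℓ hi).1 (two_mul_pos_le ℓ hi).2).le
  positivity

lemma IsPositiveSolution.mul_eq (hℓ : 0 < ℓ) (hα : 0 ≤ α) (hA : 0 ≤ A)
    (hβ : ∀ i ∈ Finset.Icc 1 k, 0 ≤ β (2 * i)) (hx : IsPositiveSolution k ℓ α A β x) {n : ℕ}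
    (hn : max (2 * k) ℓ ≤ n) :
    x n * (A + x (n - ℓ)) =
      α + ∑ i ∈ Finset.Icc 1 k, β (2 * i) * x (n - 2 * i) + x (n - ℓ) := by
  have h1 := hx.pos hℓ hα hA hβ (n - ℓ)
  rw [hx.2 n hn, ratStep, div_mul_cancel₀ _ (by positivity)]

/-- As long as it lies below `θ`, a lower bound valid on a window improves by the factor
`(B + 1) / (A + θ) > 1` after it, where `B = ∑ β (2 * i)`: a term below `1` is an increasing function
of all its delayed values, the one at delay `ℓ` included. -/
lemma IsPositiveSolution.eventually_ge (hℓ : 0 < ℓ) (hα : 0 ≤ α) (hA : 0 ≤ A)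
    (hβ : ∀ i ∈ Finset.Icc 1 k, 0 ≤ β (2 * i)) (hx : IsPositiveSolution k ℓ α A β x) {θ : ℝ}
    (hθ : 0 < θ) (hθ1 : θ ≤ 1) (hθB : A + θ < ∑ i ∈ Finset.Icc 1 k, β (2 * i) + 1) :
    ∃ N, ∀ n, N ≤ n → θ ≤ x n := by
  set B := ∑ i ∈ Finset.Icc 1 k, β (2 * i) with hB
  have hpos := hx.pos hℓ hα hA hβ
  set r := (B + 1) / (A + θ) with hr
  have hr1 : 1 < r := (one_lt_div (by positivity)).2 hθB
  -- one step of the recursion, for a lower bound `m ≤ θ` on the window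
  have step : ∀ m n, 0 < m → m ≤ θ → max (2 * k) ℓ ≤ n →
      (∀ d, 0 < d → d ≤ max (2 * k) ℓ → m ≤ x (n - d)) → min θ (r * m) ≤ x n := by
    intro m n hm hmθ hn h
    have he := hx.mul_eq hℓ hα hA hβ hn
    have hl := h ℓ hℓ (le_max_right _ _)
    have hs := le_sum_mul hβ fun i (hi : i ∈ Finset.Icc 1 k) =>
      h _ (two_mul_pos_le ℓ hi).1 (two_mul_pos_le ℓ hi).2
    rw [← hB] at hs
    set s := ∑ i ∈ Finset.Icc 1 k, β (2 * i) * x (n - 2 * i)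
    have hd : 0 < A + x (n - ℓ) := by linarith [hpos (n - ℓ)]
    rcases le_total A (α + s) with hc | hc
    · refine (min_le_left _ _).trans (hθ1.trans ?_)
      refine le_of_mul_le_mul_right ?_ hd
      linarith
    · refine (min_le_right _ _).trans ?_
      have h1 : r * m ≤ (α + s + m) / (A + m) := by
        rw [hr, div_mul_eq_mul_div, div_le_div_iff₀ (by positivity) (by positivity)]
        have : (B + 1) * m ≤ α + s + m := by linarith
        have h0 : 0 ≤ (B + 1) * m := by
          have : 0 < B + 1 := by linarith
          positivity
        exact mul_le_mul this (by linarith) (by positivity) (by linarith)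
      have h2 : (α + s + m) / (A + m) ≤ x n := by
        rw [div_le_iff₀ (by positivity)]
        have h3 : x n ≤ 1 := by
          refine le_of_mul_le_mul_right ?_ hd
          linarith
        nlinarith [mul_nonneg (sub_nonneg.2 h3) (sub_nonneg.2 hl)]
      exact h1.trans h2
  obtain ⟨m₀, hm₀, hle⟩ := exists_pos_le_of_lt x 0 (max (2 * k) ℓ) fun n _ _ => hpos n
  set m := min m₀ θ with hm
  have hm0 : 0 < m := lt_min hm₀ hθ
  have hmθ : m ≤ θ := min_le_right _ _
  have base : ∀ n, m ≤ x n := fun n =>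
    window_induction (K := max (2 * k) ℓ) (N := 0) (P := fun n => m ≤ x n)
      (fun n hn hn' => (min_le_left _ _).trans (hle n hn (by simpa using hn')))
      (fun n hn ih => (le_min hmθ (le_mul_of_one_le_left hm0.le hr1.le)).trans
        (step m n hm0 hmθ (by simpa using hn) ih)) n (Nat.zero_le n)
  have levels := window_induction_levels (K := max (2 * k) ℓ)
    (P := fun j n => min θ (r ^ j * m) ≤ x n)
    (fun n => (min_le_right _ _).trans (by simpa using base n))
    (fun j n hn ih => by
      have := step (min θ (r ^ j * m)) n (lt_min hθ (by positivity)) (min_le_left _ _) hn ih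
      refine (le_min (min_le_left _ _) ?_).trans this
      rcases le_total θ (r ^ j * m) with h | h
      · rw [min_eq_left h]
        exact (min_le_left _ _).trans (le_mul_of_one_le_left hθ.le hr1.le)
      · rw [min_eq_right h, ← mul_assoc, ← pow_succ']
        exact min_le_right _ _)
  obtain ⟨j, hj⟩ := pow_unbounded_of_one_lt (θ / m) hr1
  refine ⟨j * max (2 * k) ℓ, fun n hn => ?_⟩
  have := levels j n hn
  rwa [min_eq_left ((div_lt_iff₀ hm0).1 hj).le] at this

end Basic

/-! ### Subcritical case: convergence to an equilibrium -/

section Subcritical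

variable {k ℓ : ℕ} {α A : ℝ} {β : ℕ → ℝ} {x : ℕ → ℝ}

/-- Once `x` stays above `θ`, the coefficient `B / (A + θ)` of the earlier terms is below `1`. -/
lemma IsPositiveSolution.exists_upper_bound (hℓ : 0 < ℓ) (hα : 0 ≤ α) (hA : 0 ≤ A)
    (hβ : ∀ i ∈ Finset.Icc 1 k, 0 ≤ β (2 * i)) (hx : IsPositiveSolution k ℓ α A β x) {θ : ℝ} {N : ℕ}
    (hθB : ∑ i ∈ Finset.Icc 1 k, β (2 * i) < A + θ)
    (hN : ∀ n, N ≤ n → θ ≤ x n) : ∃ M, ∀ n, x n ≤ M := by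
  set B := ∑ i ∈ Finset.Icc 1 k, β (2 * i) with hB
  have hB0 : 0 ≤ B := Finset.sum_nonneg hβ
  have hpos := hx.pos hℓ hα hA hβ
  obtain ⟨M₀, hM₀⟩ := exists_ge_of_lt x (N + max (2 * k) ℓ)
  -- `M₁` solves `α + (A + θ) + B * M₁ = (A + θ) * M₁`
  set M₁ := (α + (A + θ)) / (A + θ - B) with hM₁
  have hM₁e : α + (A + θ) + B * M₁ = (A + θ) * M₁ := by
    have : M₁ * (A + θ - B) = α + (A + θ) := div_mul_cancel₀ _ (by linarith)
    linarith
  have hM₁1 : 1 ≤ M₁ := by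
    rw [hM₁, le_div_iff₀ (by linarith)]
    linarith
  set M := max M₀ M₁ with hM
  have hMge := window_induction (K := max (2 * k) ℓ) (N := N) (P := fun n => x n ≤ M)
    (fun n _ hn => (hM₀ n hn).trans (le_max_left _ _))
    (fun n hn ih => by
      have hl := hN (n - ℓ) (by have := le_max_right (2 * k) ℓ; omega)
      have he := hx.mul_eq hℓ hα hA hβ (n := n) (by omega)
      have hs := sum_mul_le hβ fun i (hi : i ∈ Finset.Icc 1 k) =>
        ih _ (two_mul_pos_le ℓ hi).1 (two_mul_pos_le ℓ hi).2
      rw [← hB] at hs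
      have hMM : M₁ ≤ M := le_max_right _ _
      refine le_of_mul_le_mul_right ?_ (show 0 < A + x (n - ℓ) by linarith [hpos (n - ℓ)])
      rw [he]
      nlinarith [mul_nonneg (sub_nonneg.2 hMM) (show 0 ≤ A + θ - B by linarith),
        mul_nonneg (sub_nonneg.2 hl) (show 0 ≤ M - 1 by linarith)])
  refine ⟨M, fun n => ?_⟩
  rcases lt_or_ge n N with h | h
  · exact (hM₀ n (by omega)).trans (le_max_left _ _)
  · exact hMge n h

/-- The sign of `q` is not prescribed: it decides whether the term with numerator
`q = α - A + ∑ β x` increases or decreases in the value at delay `ℓ`. -/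
lemma div_add_le_max {A a b q y : ℝ} (ha : 0 < A + a) (hay : a ≤ y) (hyb : y ≤ b) :
    q / (A + y) ≤ max (q / (A + a)) (q / (A + b)) := by
  rcases le_total 0 q with hq | hq
  · exact le_max_of_le_left (div_le_div_of_nonneg_left hq ha (by linarith))
  · refine le_max_of_le_right ?_
    rw [div_le_div_iff₀ (by linarith) (by linarith)]
    exact mul_le_mul_of_nonpos_left (by linarith) hq

lemma min_le_div_add {A a b q y : ℝ} (ha : 0 < A + a) (hay : a ≤ y) (hyb : y ≤ b) :
    min (q / (A + a)) (q / (A + b)) ≤ q / (A + y) := by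
  have := div_add_le_max (q := -q) ha hay hyb
  rw [neg_div, neg_div, neg_div, max_neg_neg] at this
  linarith

/-- One application of the recursion, in the form
`x n = 1 + (α - A + ∑ β x (n - 2i)) / (A + x (n - ℓ))`, to bounds valid at all large times. -/
lemma IsPositiveSolution.eventually_bounds (hℓ : 0 < ℓ) (hα : 0 ≤ α) (hA : 0 ≤ A)
    (hβ : ∀ i ∈ Finset.Icc 1 k, 0 ≤ β (2 * i)) (hx : IsPositiveSolution k ℓ α A β x) {a b : ℝ}
    (ha : 0 < A + a) (hev : ∀ᶠ n in atTop, a ≤ x n ∧ x n ≤ b) :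
    ∀ᶠ n in atTop,
      1 + min ((α - A + (∑ i ∈ Finset.Icc 1 k, β (2 * i)) * a) / (A + a))
        ((α - A + (∑ i ∈ Finset.Icc 1 k, β (2 * i)) * a) / (A + b)) ≤ x n ∧
      x n ≤ 1 + max ((α - A + (∑ i ∈ Finset.Icc 1 k, β (2 * i)) * b) / (A + a))
        ((α - A + (∑ i ∈ Finset.Icc 1 k, β (2 * i)) * b) / (A + b)) := by
  obtain ⟨N, hN⟩ := eventually_atTop.1 hev
  filter_upwards [eventually_ge_atTop (N + max (2 * k) ℓ)] with n hn
  have hw : ∀ d, d ≤ max (2 * k) ℓ → a ≤ x (n - d) ∧ x (n - d) ≤ b := fun d hd =>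
    hN _ (by omega)
  have hl := hw ℓ (le_max_right _ _)
  have he := hx.mul_eq hℓ hα hA hβ (n := n) (by omega)
  have hs := sum_mul_le hβ fun i (hi : i ∈ Finset.Icc 1 k) => (hw _ (two_mul_pos_le ℓ hi).2).2
  have hs' := le_sum_mul hβ fun i (hi : i ∈ Finset.Icc 1 k) => (hw _ (two_mul_pos_le ℓ hi).2).1
  set s := ∑ i ∈ Finset.Icc 1 k, β (2 * i) * x (n - 2 * i)
  have hd : 0 < A + x (n - ℓ) := by linarith
  have hxn : x n = 1 + (α - A + s) / (A + x (n - ℓ)) := by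
    field_simp
    linarith
  constructor
  · rw [hxn]
    have h1 := min_le_div_add (q := α - A + (∑ i ∈ Finset.Icc 1 k, β (2 * i)) * a) ha hl.1 hl.2
    have h2 := div_le_div_of_nonneg_right (add_le_add_right hs' (α - A)) hd.le
    linarith
  · rw [hxn]
    have h1 := div_add_le_max (q := α - A + (∑ i ∈ Finset.Icc 1 k, β (2 * i)) * b) ha hl.1 hl.2
    have h2 := div_le_div_of_nonneg_right (add_le_add_right hs (α - A)) hd.le
    linarith

/-- The algebra behind the convergence: `S` and `I` stand for the upper and the lower limit of a
solution, `B` for the sum of the `β`, and `θ` for an eventual lower bound. -/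
lemma eq_of_limit_bounds {α A B θ S I : ℝ} (hα : 0 ≤ α) (hθ : 0 ≤ θ)
    (hθA : 0 < θ ∨ B + 1 ≤ A) (hBθ : B < A + θ) (hB : B < A + 1) (hB0 : 0 ≤ B)
    (hθI : θ ≤ I) (hIS : I ≤ S)
    (hS : S ≤ 1 + max ((α - A + B * S) / (A + I)) ((α - A + B * S) / (A + S)))
    (hI : 1 + min ((α - A + B * I) / (A + I)) ((α - A + B * I) / (A + S)) ≤ I) : S = I := by
  have hAI : 0 < A + I := by linarith
  have hAS : 0 < A + S := by linarith
  have hS' : S * (A + I) ≤ α + B * S + I ∨ S * (A + S) ≤ α + B * S + S := by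
    rcases le_max_iff.1 (sub_le_iff_le_add'.2 hS) with h | h
    · left
      rw [le_div_iff₀ hAI] at h
      linarith
    · right
      rw [le_div_iff₀ hAS] at h
      linarith
  have hI' : α + B * I + I ≤ I * (A + I) ∨ α + B * I + S ≤ I * (A + S) := by
    rcases min_le_iff.1 (le_sub_iff_add_le'.2 hI) with h | h
    · left
      rw [div_le_iff₀ hAI] at h
      linarith
    · right
      rw [div_le_iff₀ hAS] at h
      linarith
  refine le_antisymm ?_ hIS
  by_contra! hlt
  have hd : 0 < S - I := sub_pos.2 hlt
  rcases hS' with hS' | hS' <;> rcases hI' with hI' | hI'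
  · -- `(S - I) * (A + I - B) ≤ 0`
    nlinarith [mul_pos hd (show 0 < A + I - B by linarith)]
  · nlinarith [mul_pos hd (show 0 < A + 1 - B by linarith)]
  · have h1 : (S - I) * (S + I + A - B - 1) ≤ 0 := by nlinarith
    have h2 : S + I + A - B - 1 ≤ 0 := by
      by_contra! h
      exact absurd (mul_pos hd h) (not_lt.2 h1)
    have h3 : 0 ≤ I * (I + A - B - 1) := by nlinarith
    rcases hθA with h | h
    · have h4 : 0 ≤ I + A - B - 1 := nonneg_of_mul_nonneg_right h3 (by linarith)
      linarith
    · linarith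
  · nlinarith [mul_pos hd (show 0 < A + S - B by linarith)]

theorem IsPositiveSolution.tendsto_equilibrium (hℓ : 0 < ℓ) (hα : 0 ≤ α) (hA : 0 ≤ A)
    (hβ : ∀ i ∈ Finset.Icc 1 k, 0 ≤ β (2 * i)) (hB : ∑ i ∈ Finset.Icc 1 k, β (2 * i) < A + 1)
    (hx : IsPositiveSolution k ℓ α A β x) :
    ∃ c : ℝ, IsEquilibrium k ℓ α A β c ∧ Tendsto x atTop (𝓝 c) := by
  have hpos := hx.pos hℓ hα hA hβ
  have hbounds := fun a b => hx.eventually_bounds hℓ hα hA hβ (a := a) (b := b)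
  have hB0 : 0 ≤ ∑ i ∈ Finset.Icc 1 k, β (2 * i) := Finset.sum_nonneg hβ
  have hupper := fun θ N => hx.exists_upper_bound hℓ hα hA hβ (θ := θ) (N := N)
  have hlower := fun θ => hx.eventually_ge hℓ hα hA hβ (θ := θ)
  have heq : ∀ c n, ratStep k ℓ α A β (fun _ => c) n =
      (α + (∑ i ∈ Finset.Icc 1 k, β (2 * i)) * c + c) / (A + c) := fun c n => by
    rw [ratStep, Finset.sum_mul]
  set B := ∑ i ∈ Finset.Icc 1 k, β (2 * i) with hBdef
  -- an eventual lower bound that keeps `A + x` above `B` and, if `0` repels, `x` away from `0`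
  obtain ⟨θ, hθ, hθA, hBθ, N, hN⟩ : ∃ θ, 0 ≤ θ ∧ (0 < θ ∨ B + 1 ≤ A) ∧ B < A + θ ∧
      ∃ N, ∀ n, N ≤ n → θ ≤ x n := by
    rcases lt_or_ge A (B + 1) with h | h
    · exact ⟨(B + 1 - A) / 2, by linarith, Or.inl (by linarith), by linarith,
        hlower _ (by linarith) (by linarith) (by linarith)⟩
    · exact ⟨0, le_rfl, Or.inr h, by linarith, 0, fun n _ => (hpos n).le⟩
  obtain ⟨M, hM⟩ := hupper θ N hBθ hN
  have hba : atTop.IsBoundedUnder (· ≤ ·) x :=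
    isBoundedUnder_of_eventually_le (Eventually.of_forall hM)
  have hev : ∀ᶠ n in atTop, θ ≤ x n := eventually_atTop.2 ⟨N, hN⟩
  have hbb : atTop.IsBoundedUnder (· ≥ ·) x := isBoundedUnder_of_eventually_ge hev
  set S := limsup x atTop with hS
  set I := liminf x atTop with hI
  have hIS : I ≤ S := liminf_le_limsup hba hbb
  have hθI : θ ≤ I := le_liminf_of_le hba.isCoboundedUnder_ge hev
  have hAI : 0 < A + I := by linarith
  have hAS : 0 < A + S := by linarith
  have h0 : Tendsto (fun ε : ℝ => ε) (𝓝[>] 0) (𝓝 0) := tendsto_nhdsWithin_of_tendsto_nhds tendsto_id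
  have hSε : Tendsto (fun ε : ℝ => S + ε) (𝓝[>] 0) (𝓝 S) := by simpa using h0.const_add S
  have hIε : Tendsto (fun ε : ℝ => I - ε) (𝓝[>] 0) (𝓝 I) := by simpa using h0.const_sub I
  have hsmall : ∀ᶠ ε in 𝓝[>] (0 : ℝ), 0 < ε ∧ 0 < A + (I - ε) := by
    refine (eventually_mem_nhdsWithin (s := Set.Ioi (0 : ℝ))).and ?_
    exact (hIε.const_add A).eventually (lt_mem_nhds hAI)
  have hbd : ∀ ε, 0 < ε → ∀ᶠ n in atTop, I - ε ≤ x n ∧ x n ≤ S + ε := fun ε hε => by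
    filter_upwards [eventually_lt_of_limsup_lt (show limsup x atTop < S + ε by linarith) hba,
      eventually_lt_of_lt_liminf (show I - ε < liminf x atTop by linarith) hbb] with n h1 h2
    exact ⟨h2.le, h1.le⟩
  have hS1 : S ≤ 1 + max ((α - A + B * S) / (A + I)) ((α - A + B * S) / (A + S)) := by
    refine ge_of_tendsto (x := 𝓝[>] (0 : ℝ))
      (f := fun ε => 1 + max ((α - A + B * (S + ε)) / (A + (I - ε)))
        ((α - A + B * (S + ε)) / (A + (S + ε)))) ?_ ?_
    · have hq := (hSε.const_mul B).const_add (α - A)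
      exact ((hq.div (hIε.const_add A) hAI.ne').max (hq.div (hSε.const_add A) hAS.ne')).const_add 1
    · filter_upwards [hsmall] with ε hε
      exact limsup_le_of_le hbb.isCoboundedUnder_le
        ((hbounds _ _ hε.2 (hbd ε hε.1)).mono fun n hn => hn.2)
  have hI1 : 1 + min ((α - A + B * I) / (A + I)) ((α - A + B * I) / (A + S)) ≤ I := by
    refine le_of_tendsto (x := 𝓝[>] (0 : ℝ))
      (f := fun ε => 1 + min ((α - A + B * (I - ε)) / (A + (I - ε)))
        ((α - A + B * (I - ε)) / (A + (S + ε)))) ?_ ?_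
    · have hq := (hIε.const_mul B).const_add (α - A)
      exact ((hq.div (hIε.const_add A) hAI.ne').min (hq.div (hSε.const_add A) hAS.ne')).const_add 1
    · filter_upwards [hsmall] with ε hε
      exact le_liminf_of_le hba.isCoboundedUnder_ge
        ((hbounds _ _ hε.2 (hbd ε hε.1)).mono fun n hn => hn.1)
  have hSI : S = I := eq_of_limit_bounds hα hθ hθA hBθ hB hB0 hθI hIS hS1 hI1
  refine ⟨I, ⟨hθ.trans hθI, hAI, fun n => ?_⟩,
    tendsto_of_liminf_eq_limsup hI.symm (hS.symm.trans hSI) hba hbb⟩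
  rw [hSI, max_self] at hS1
  rw [hSI, min_self] at hI1
  have he : I = 1 + (α - A + B * I) / (A + I) := le_antisymm hS1 hI1
  rw [heq]
  calc I = 1 + (α - A + B * I) / (A + I) := he
    _ = (α + B * I + I) / (A + I) := by
      field_simp
      ring

end Subcritical

/-! ### Supercritical case: an unbounded solution -/

/-- The solution whose initial conditions are the values of `f` before the largest delay. -/
noncomputable def ratSolution (k ℓ : ℕ) (α A : ℝ) (β f : ℕ → ℝ) (n : ℕ) : ℝ :=
  if n < max (2 * k) ℓ then f n
  else ratStep k ℓ α A β (fun m => if m < n then ratSolution k ℓ α A β f m else 0) n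

lemma isPositiveSolution_ratSolution {k ℓ : ℕ} {α A : ℝ} {β f : ℕ → ℝ} (hℓ : 0 < ℓ)
    (hf : ∀ n, n < max (2 * k) ℓ → 0 < f n) :
    IsPositiveSolution k ℓ α A β (ratSolution k ℓ α A β f) := by
  refine ⟨fun n hn => ?_, fun n hn => ?_⟩
  · rw [ratSolution, if_pos hn]
    exact hf n hn
  · have hn0 : 0 < n := lt_of_lt_of_le (lt_max_of_lt_right hℓ) hn
    have hs : ∀ d, 0 < d → n - d < n := fun d hd => by omega
    rw [ratSolution, if_neg (not_lt.2 hn), ratStep, ratStep, if_pos (hs ℓ hℓ)]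
    congr 3
    refine Finset.sum_congr rfl fun i hi => ?_
    rw [if_pos (hs _ (two_mul_pos_le ℓ hi).1)]

/-- Initial conditions that are large at even times and slightly above `1` at odd times make the
subsequence of even index grow geometrically: as `ℓ` is odd and the other delays are even, large
numerators meet small denominators at even times, and the reverse holds at odd times. -/
theorem exists_unbounded_solution {k ℓ : ℕ} {α A : ℝ} {β : ℕ → ℝ} (hℓ : Odd ℓ) (hα : 0 ≤ α)
    (hA : 0 ≤ A) (hβ : ∀ i ∈ Finset.Icc 1 k, 0 ≤ β (2 * i))
    (hB : A + 1 < ∑ i ∈ Finset.Icc 1 k, β (2 * i)) :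
    ∃ x : ℕ → ℝ, IsPositiveSolution k ℓ α A β x ∧ ¬ BddAbove (Set.range x) := by
  have hsum_le := fun (x : ℕ → ℝ) n M => sum_mul_le (x := x) hβ (n := n) (M := M)
  have hle_sum := fun (x : ℕ → ℝ) n M => le_sum_mul (x := x) hβ (n := n) (m := M)
  set B := ∑ i ∈ Finset.Icc 1 k, β (2 * i) with hBdef
  -- `1 + δ` bounds the odd terms, `a` the even ones; `r` is the growth factor
  set δ := (B - (A + 1)) / 2 with hδ
  have hδ0 : 0 < δ := by rw [hδ]; linarith
  have hAδ : A + (1 + δ) < B := by rw [hδ]; linarith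
  set a := (α + B * (1 + δ)) / δ with ha
  have hB0 : 0 < B := by linarith
  have ha0 : 0 < a := by positivity
  have haδ : a * δ = α + B * (1 + δ) := div_mul_cancel₀ _ hδ0.ne'
  set r := B / (A + (1 + δ)) with hr
  have hr1 : 1 < r := (one_lt_div (by positivity)).2 hAδ
  set f : ℕ → ℝ := fun n => if Even n then a else 1 + δ with hf
  have hx := isPositiveSolution_ratSolution (k := k) (ℓ := ℓ) (α := α) (A := A) (β := β) (f := f)
    hℓ.pos (fun n _ => by
      rw [hf]
      dsimp only
      split_ifs <;> positivity)
  have hinit : ∀ n, n < max (2 * k) ℓ → ratSolution k ℓ α A β f n = f n := fun n hn => by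
    rw [ratSolution, if_pos hn]
  set x := ratSolution k ℓ α A β f
  have hpos := hx.pos hℓ.pos hα hA hβ
  have heven : ∀ (y : ℝ) (n : ℕ), max (2 * k) ℓ ≤ n → x (n - ℓ) ≤ 1 + δ →
      (∀ i ∈ Finset.Icc 1 k, y ≤ x (n - 2 * i)) → r * y ≤ x n := by
    intro y n hn hl hy
    have he := hx.mul_eq hℓ.pos hα hA hβ hn
    have hs := hle_sum x n y hy
    have h1 := hpos (n - ℓ)
    have h2 : x n * (A + x (n - ℓ)) ≤ x n * (A + (1 + δ)) :=
      mul_le_mul_of_nonneg_left (by linarith) (hpos n).le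
    rw [hr, div_mul_eq_mul_div, div_le_iff₀ (by positivity)]
    linarith
  have hpar_even : ∀ n i : ℕ, i ∈ Finset.Icc 1 k → max (2 * k) ℓ ≤ n →
      (Even (n - 2 * i) ↔ Even n) := fun n i hi hn =>
    even_sub_two_mul_iff ((two_mul_pos_le ℓ hi).2.trans hn)
  have hpar_odd : ∀ n : ℕ, max (2 * k) ℓ ≤ n → (Even (n - ℓ) ↔ ¬ Even n) := fun n hn =>
    even_sub_odd_iff hℓ ((le_max_right _ _).trans hn)
  have hbox : ∀ n, (Even n → a ≤ x n) ∧ (¬ Even n → x n ≤ 1 + δ) := fun n => by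
    refine window_induction (K := max (2 * k) ℓ) (N := 0)
      (P := fun n => (Even n → a ≤ x n) ∧ (¬ Even n → x n ≤ 1 + δ))
      (fun n _ hn => ?_) (fun n hn ih => ?_) n (Nat.zero_le n)
    · rw [hinit n (by simpa using hn), hf]
      exact ⟨fun h => (if_pos h).ge, fun h => (if_neg h).le⟩
    · rw [zero_add] at hn
      have hl := ih ℓ hℓ.pos (le_max_right _ _)
      rw [hpar_odd n hn] at hl
      have hi := fun i (hi : i ∈ Finset.Icc 1 k) =>
        ih _ (two_mul_pos_le ℓ hi).1 (two_mul_pos_le ℓ hi).2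
      refine ⟨fun hev => ?_, fun hodd => ?_⟩
      · refine (le_mul_of_one_le_left ha0.le hr1.le).trans
          (heven a n hn (hl.2 (not_not.2 hev)) fun i hik => ?_)
        exact (hi i hik).1 ((hpar_even n i hik hn).2 hev)
      · have he := hx.mul_eq hℓ.pos hα hA hβ hn
        have hs := hsum_le x n (1 + δ) fun i hik =>
          (hi i hik).2 (mt (hpar_even n i hik hn).1 hodd)
        have h1 := hl.1 hodd
        refine le_of_mul_le_mul_right ?_ (show 0 < A + x (n - ℓ) by linarith)
        nlinarith [mul_nonneg (sub_nonneg.2 h1) hδ0.le, mul_nonneg hA hδ0.le]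
  have hgrow := window_induction_levels (K := max (2 * k) ℓ)
    (P := fun j n => Even n → r ^ j * a ≤ x n)
    (fun n hev => by simpa using (hbox n).1 hev)
    (fun j n hn ih hev => by
      rw [pow_succ', mul_assoc]
      refine heven _ n hn ((hbox _).2 ?_) fun i hi =>
        ih _ (two_mul_pos_le ℓ hi).1 (two_mul_pos_le ℓ hi).2 ((hpar_even n i hi hn).2 hev)
      rw [hpar_odd n hn]
      exact not_not.2 hev)
  refine ⟨x, hx, fun ⟨M, hM⟩ => ?_⟩
  obtain ⟨j, hj⟩ := pow_unbounded_of_one_lt (M / a) hr1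
  have h1 := hgrow j (2 * (j * max (2 * k) ℓ)) (by omega) (even_two_mul _)
  have h2 := hM (Set.mem_range_self (2 * (j * max (2 * k) ℓ)))
  rw [div_lt_iff₀ ha0] at hj
  linarith

/-! ### Recursions by weighted means -/

/-- Let every term of `v` be a weighted mean of the terms `v (n - d)`, `d ∈ D`, with weights bounded
below by `c d > 0`. If `g` divides all delays and all large multiples of `g` are sums of delays,
then `v` converges along each residue class modulo `g`. -/
lemma exists_tendsto_residue_of_mean {D : Finset ℕ} {K N g : ℕ} (hg : g ≠ 0)
    (hD : ∀ d ∈ D, 0 < d ∧ d ≤ K ∧ g ∣ d)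
    (hcl : ∃ M, ∀ m ≥ M, g ∣ m → m ∈ AddSubmonoid.closure (D : Set ℕ))
    {c : ℕ → ℝ} (hc : ∀ d ∈ D, 0 < c d) {v : ℕ → ℝ} {a b : ℝ}
    (hab : ∀ n, N ≤ n → a ≤ v n ∧ v n ≤ b)
    (hup : ∀ n, N + K ≤ n → ∀ S, (∀ d ∈ D, v (n - d) ≤ S) →
      ∀ d ∈ D, c d * (S - v (n - d)) ≤ S - v n)
    (hlo : ∀ n, N + K ≤ n → ∀ s, (∀ d ∈ D, s ≤ v (n - d)) → s ≤ v n) (r : ℕ) :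
    ∃ L, a ≤ L ∧ Tendsto v (atTop ⊓ 𝓟 {n | n ≡ r [MOD g]}) (𝓝 L) := by
  set F : Filter ℕ := atTop ⊓ 𝓟 {n | n ≡ r [MOD g]} with hF
  have hFtop : F ≤ atTop := inf_le_left
  have hFr : ∀ᶠ n in F, n ≡ r [MOD g] := mem_inf_of_right (mem_principal_self _)
  have hFne : F.NeBot := by
    rw [hF, ← frequently_iff_neBot]
    exact Nat.frequently_modEq hg r
  have hFge : ∀ m, ∀ᶠ n in F, m ≤ n := fun m => hFtop (eventually_ge_atTop m)
  have hsh : ∀ m, g ∣ m → Tendsto (fun n => n - m) F F := by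
    intro m hm
    refine tendsto_inf.2 ⟨(tendsto_sub_atTop_nat m).mono_left hFtop, tendsto_principal.2 ?_⟩
    filter_upwards [hFr, hFge m] with n hn hmn
    refine Nat.ModEq.trans ?_ hn
    exact (Nat.modEq_iff_dvd' (Nat.sub_le n m)).2 (by rwa [Nat.sub_sub_self hmn])
  have hba : F.IsBoundedUnder (· ≤ ·) v :=
    isBoundedUnder_of_eventually_le ((hFge N).mono fun n hn => (hab n hn).2)
  have hbb : F.IsBoundedUnder (· ≥ ·) v :=
    isBoundedUnder_of_eventually_ge ((hFge N).mono fun n hn => (hab n hn).1)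
  set S := limsup v F with hS
  have hevS : ∀ S', S < S' → ∀ᶠ n in F, v n < S' := fun S' h =>
    eventually_lt_of_limsup_lt h hba
  obtain ⟨U, hUF, hU⟩ : ∃ U : Ultrafilter ℕ, ↑U ≤ F ∧ Tendsto v U (𝓝 S) := by
    rw [← mapClusterPt_iff_ultrafilter, mapClusterPt_iff_frequently]
    intro s hs
    obtain ⟨ε, hε, hball⟩ := Metric.mem_nhds_iff.1 hs
    have h1 : ∃ᶠ n in F, S - ε < v n :=
      frequently_lt_of_lt_limsup hbb.isCoboundedUnder_le (by linarith)
    refine (h1.and_eventually (hevS (S + ε) (by linarith))).mono fun n hn => hball ?_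
    rw [Metric.mem_ball, Real.dist_eq, abs_lt]
    constructor <;> linarith [hn.1, hn.2]
  -- a term close to the upper limit forces the delayed terms to be close to it as well
  have key : ∀ m ∈ AddSubmonoid.closure (D : Set ℕ),
      g ∣ m ∧ Tendsto (fun n => v (n - m)) U (𝓝 S) := by
    intro m hm
    induction hm using AddSubmonoid.closure_induction_left with
    | zero => exact ⟨dvd_zero g, by simpa using hU⟩
    | add_left d hd m hm ih =>
      have hgd := (hD d hd).2.2
      refine ⟨dvd_add hgd ih.1, tendsto_order.2 ⟨fun S' hS' => ?_, fun S' hS' => ?_⟩⟩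
      · set ε := S - S' with hε
        have hcd := hc d hd
        have hε0 : 0 < ε := by rw [hε]; linarith
        set δ := c d * ε / 2 with hδ
        have hδ0 : 0 < δ := by positivity
        have h1 : ∀ᶠ n in (U : Filter ℕ), ∀ e ∈ D, v (n - m - e) < S + δ := by
          rw [eventually_all_finset]
          intro e he
          exact hUF ((hsh m ih.1).eventually
            ((hsh e (hD e he).2.2).eventually (hevS (S + δ) (by linarith))))
        filter_upwards [h1, ih.2.eventually (lt_mem_nhds (show S - δ < S by linarith)),
          hUF (hFge (N + K + m))] with n h1 h2 h3
        have h4 := hup (n - m) (by omega) (S + δ) (fun e he => (h1 e he).le) d hd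
        rw [add_comm d m, ← Nat.sub_sub]
        by_contra! h5
        have h6 : c d * (ε + δ) ≤ c d * (S + δ - v (n - m - d)) :=
          mul_le_mul_of_nonneg_left (by linarith) hcd.le
        have h7 : 0 < c d * δ := by positivity
        have h8 : c d * ε = 2 * δ := by rw [hδ]; ring
        linarith [mul_add (c d) ε δ]
      · exact hUF ((hsh _ (dvd_add hgd ih.1)).eventually (hevS S' hS'))
  refine ⟨S, ?_, tendsto_order.2 ⟨fun S' hS' => ?_, hevS⟩⟩
  · exact ge_of_tendsto hU (hUF ((hFge N).mono fun n hn => (hab n hn).1))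
  obtain ⟨M, hM⟩ := hcl
  obtain ⟨S'', h2, h3⟩ := exists_between hS'
  -- a whole window of terms close to the upper limit keeps all later terms close to it
  have h1 : ∀ᶠ n in (U : Filter ℕ), ∀ m ∈ Finset.Icc M (M + K), g ∣ m → S'' < v (n - m) := by
    rw [eventually_all_finset]
    intro m hm
    by_cases hgm : g ∣ m
    · filter_upwards [(key m (hM m (Finset.mem_Icc.1 hm).1 hgm)).2.eventually (lt_mem_nhds h3)]
        with n hn _ using hn
    · exact Eventually.of_forall fun n h => absurd h hgm
  obtain ⟨n, hn1, hnr, hnN⟩ := (h1.and (hUF (hFr.and (hFge (N + M + K))))).exists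
  have h4 := window_induction (K := K) (N := n - (M + K))
    (P := fun j => j ≡ r [MOD g] → S'' ≤ v j)
    (fun j hj1 hj2 hjr => by
      have h5 : g ∣ n - j := (Nat.modEq_iff_dvd' (by omega)).1 (hjr.trans hnr.symm)
      have := hn1 (n - j) (Finset.mem_Icc.2 ⟨by omega, by omega⟩) h5
      rw [Nat.sub_sub_self (by omega)] at this
      exact this.le)
    (fun j hj ih hjr => hlo j (by omega) S'' fun d hd => by
      obtain ⟨hd0, hdK, hgd⟩ := hD d hd
      refine ih d hd0 hdK (Nat.ModEq.trans ?_ hjr)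
      exact (Nat.modEq_iff_dvd' (Nat.sub_le j d)).2 (by rwa [Nat.sub_sub_self (by omega)]))
  filter_upwards [hFr, hFge (n - (M + K))] with j hjr hj
  exact h2.trans_le (h4 j hj hjr)

/-- The limits along the residue classes form a periodic sequence. -/
lemma exists_periodic_tendsto_sub {g : ℕ} (hg : g ≠ 0) {v : ℕ → ℝ} {a : ℝ}
    (h : ∀ r, ∃ L, a ≤ L ∧ Tendsto v (atTop ⊓ 𝓟 {n | n ≡ r [MOD g]}) (𝓝 L)) :
    ∃ w : ℕ → ℝ, (∀ n, a ≤ w n) ∧ Function.Periodic w g ∧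
      Tendsto (fun n => v n - w n) atTop (𝓝 0) := by
  choose L hL hlim using h
  refine ⟨fun n => L (n % g), fun n => hL _, fun n => by simp, ?_⟩
  rw [Metric.tendsto_nhds]
  intro ε hε
  have h1 : ∀ᶠ n in atTop, ∀ r ∈ Finset.range g, n ≡ r [MOD g] → dist (v n) (L r) < ε := by
    rw [eventually_all_finset]
    intro r _
    exact eventually_inf_principal.1 ((hlim r).eventually (Metric.ball_mem_nhds _ hε))
  filter_upwards [h1] with n hn
  have := hn (n % g) (Finset.mem_range.2 (Nat.mod_lt n (Nat.pos_of_ne_zero hg)))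
    (Nat.mod_modEq n g).symm
  rwa [Real.dist_eq, sub_zero]

/-! ### Critical case: convergence to periodic solutions -/

section Critical

variable {k ℓ : ℕ} {α A : ℝ} {β : ℕ → ℝ} {x : ℕ → ℝ}

lemma mem_numeratorDelays {d : ℕ} :
    d ∈ numeratorDelays k ℓ β ↔ d = ℓ ∨ ∃ i ∈ Finset.Icc 1 k, 0 < β (2 * i) ∧ 2 * i = d := by
  simp [numeratorDelays, and_assoc]

lemma delayGcd_dvd {d : ℕ} (hd : d ∈ numeratorDelays k ℓ β) : delayGcd k ℓ β ∣ d :=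
  Finset.gcd_dvd (f := id) hd

lemma delayGcd_dvd_right : delayGcd k ℓ β ∣ ℓ :=
  delayGcd_dvd (mem_numeratorDelays.2 (Or.inl rfl))

lemma delayGcd_dvd_two_mul {i : ℕ} (hi : i ∈ Finset.Icc 1 k) (h : 0 < β (2 * i)) :
    delayGcd k ℓ β ∣ 2 * i :=
  delayGcd_dvd (mem_numeratorDelays.2 (Or.inr ⟨i, hi, h, rfl⟩))

lemma odd_delayGcd (hℓ : Odd ℓ) : Odd (delayGcd k ℓ β) := hℓ.of_dvd_nat delayGcd_dvd_right

lemma exists_mem_closure_numeratorDelays :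
    ∃ M, ∀ m ≥ M, delayGcd k ℓ β ∣ m →
      m ∈ AddSubmonoid.closure (numeratorDelays k ℓ β : Set ℕ) := by
  obtain ⟨M, hM⟩ := Nat.exists_mem_closure_of_ge (numeratorDelays k ℓ β : Set ℕ)
  refine ⟨M, fun m hm hd => hM m hm (dvd_trans (Finset.dvd_gcd fun d hd => ?_) hd)⟩
  exact Nat.setGcd_dvd_of_mem (by exact_mod_cast hd)

/-- The sequence equal to `u n` at even times and to `γ / u n` at odd times. It is applied to the
excess `u n = x n - 1` of a solution, with `γ = α + 1`; on sequences it is an involution, so it also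
leads back to solutions. -/
noncomputable def parityTwist (γ : ℝ) (u : ℕ → ℝ) (n : ℕ) : ℝ :=
  if Even n then u n else γ / u n

lemma parityTwist_pos {γ : ℝ} {u : ℕ → ℝ} {n : ℕ} (hγ : 0 < γ) (hu : 0 < u n) :
    0 < parityTwist γ u n := by
  rw [parityTwist]
  split_ifs <;> positivity

lemma parityTwist_parityTwist {γ : ℝ} (hγ : γ ≠ 0) (u : ℕ → ℝ) :
    parityTwist γ (parityTwist γ u) = u := by
  ext n
  by_cases h : Even n
  · simp [parityTwist, h]
  · simp [parityTwist, h, div_div_cancel₀ hγ]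

lemma Function.Periodic.nat_sub_eq_of_dvd {w : ℕ → ℝ} {g d n : ℕ} (hw : Function.Periodic w g)
    (hd : g ∣ d) (hn : d ≤ n) : w (n - d) = w n := by
  obtain ⟨q, rfl⟩ := hd
  have := hw.nat_mul q (n - g * q)
  rw [mul_comm, Nat.cast_id, mul_comm, Nat.sub_add_cancel hn] at this
  exact this.symm

lemma periodic_one_add_parityTwist {γ : ℝ} {w : ℕ → ℝ} {g : ℕ} (hw : Function.Periodic w g) :
    Function.Periodic (fun n => 1 + parityTwist γ w n) (2 * g) := fun n => by
  have h1 : w (n + 2 * g) = w n := by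
    have := hw.nat_mul 2 n
    simpa using this
  have h2 : Even (n + 2 * g) ↔ Even n := by
    rw [Nat.even_add]
    simp
  simp only [parityTwist, h1, h2]

/-- In the critical case a `g`-periodic positive sequence `w` yields a solution of period `2 * g`:
even delays with positive coefficient are multiples of `2 * g`, and the delay `ℓ` is an odd multiple
of `g`, so that the equation reduces to `(y n - 1) * (y (n - ℓ) - 1) = α + 1`. -/
lemma isPositiveSolution_one_add_parityTwist (hℓ : Odd ℓ) (hα : 0 ≤ α) (hA : 0 ≤ A)
    (hβ : ∀ i ∈ Finset.Icc 1 k, 0 ≤ β (2 * i)) (hB : A + 1 = ∑ i ∈ Finset.Icc 1 k, β (2 * i))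
    {w : ℕ → ℝ} (hw0 : ∀ n, 0 < w n) (hw : Function.Periodic w (delayGcd k ℓ β)) :
    IsPositiveSolution k ℓ α A β (fun n => 1 + parityTwist (α + 1) w n) := by
  have hγ : 0 < α + 1 := by linarith
  have hpos : ∀ n, 0 < 1 + parityTwist (α + 1) w n := fun n => by
    have := parityTwist_pos hγ (hw0 n)
    positivity
  refine ⟨fun n _ => hpos n, fun n hn => ?_⟩
  have hsum : ∑ i ∈ Finset.Icc 1 k, β (2 * i) * (1 + parityTwist (α + 1) w (n - 2 * i)) =
      (A + 1) * (1 + parityTwist (α + 1) w n) := by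
    rw [hB, Finset.sum_mul]
    refine Finset.sum_congr rfl fun i hi => ?_
    rcases (hβ i hi).eq_or_lt with h | h
    · rw [← h, zero_mul, zero_mul]
    · have hin : 2 * i ≤ n := (two_mul_pos_le ℓ hi).2.trans hn
      simp only [parityTwist, even_sub_two_mul_iff hin,
        hw.nat_sub_eq_of_dvd (delayGcd_dvd_two_mul hi h) hin]
  have hprod : parityTwist (α + 1) w n * parityTwist (α + 1) w (n - ℓ) = α + 1 := by
    have hln : ℓ ≤ n := (le_max_right _ _).trans hn
    have := (hw0 n).ne'
    simp only [parityTwist, even_sub_odd_iff hℓ hln, hw.nat_sub_eq_of_dvd delayGcd_dvd_right hln]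
    by_cases h : Even n
    · simp only [h, not_true_eq_false, if_true, if_false]
      field_simp
    · simp only [h, not_false_eq_true, if_true, if_false]
      field_simp
  have hl := hpos (n - ℓ)
  rw [ratStep, hsum, eq_div_iff (by positivity)]
  linarith

/-- The twisted excess of a solution above `1` is a weighted mean of its delayed values. -/
lemma exists_weights_parityTwist (hℓ : Odd ℓ) (hα : 0 ≤ α) (hA : 0 ≤ A)
    (hβ : ∀ i ∈ Finset.Icc 1 k, 0 ≤ β (2 * i)) (hB : A + 1 = ∑ i ∈ Finset.Icc 1 k, β (2 * i))
    (hx : IsPositiveSolution k ℓ α A β x) {v : ℕ → ℝ}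
    (hv : v = parityTwist (α + 1) (fun n => x n - 1)) {n : ℕ} (hn : max (2 * k) ℓ ≤ n)
    (h1 : ∀ d, d ≤ max (2 * k) ℓ → 1 < x (n - d)) :
    ∃ b : ℕ → ℝ, (∀ i ∈ Finset.Icc 1 k, b i = v (n - ℓ) / (α + 1) ∨ b i = 1 / v (n - 2 * i)) ∧
      (1 + ∑ i ∈ Finset.Icc 1 k, β (2 * i) * b i) * v n =
        v (n - ℓ) + ∑ i ∈ Finset.Icc 1 k, β (2 * i) * b i * v (n - 2 * i) := by
  have hγ : 0 < α + 1 := by linarith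
  have hln : ℓ ≤ n := (le_max_right _ _).trans hn
  have hin : ∀ i ∈ Finset.Icc 1 k, 2 * i ≤ n := fun i hi => (two_mul_pos_le ℓ hi).2.trans hn
  have hxn : 0 < x n - 1 := by simpa using h1 0 (Nat.zero_le _)
  have hxl : 0 < x (n - ℓ) - 1 := by linarith [h1 ℓ (le_max_right _ _)]
  have hxi : ∀ i ∈ Finset.Icc 1 k, 0 < x (n - 2 * i) - 1 := fun i hi => by
    linarith [h1 _ (two_mul_pos_le ℓ hi).2]
  -- the equation for the excess `x - 1`
  have he : (x n - 1) * (A + 1 + (x (n - ℓ) - 1)) =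
      α + 1 + ∑ i ∈ Finset.Icc 1 k, β (2 * i) * (x (n - 2 * i) - 1) := by
    have := hx.mul_eq hℓ.pos hα hA hβ hn
    simp only [mul_sub, mul_one, Finset.sum_sub_distrib, ← hB]
    linarith
  by_cases h : Even n
  · refine ⟨fun _ => v (n - ℓ) / (α + 1), fun i hi => Or.inl rfl, ?_⟩
    have hvl : v (n - ℓ) = (α + 1) / (x (n - ℓ) - 1) := by
      rw [hv, parityTwist, if_neg (by rw [even_sub_odd_iff hℓ hln]; exact not_not.2 h)]
    have hvn : v n = x n - 1 := by rw [hv, parityTwist, if_pos h]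
    have hs : ∑ i ∈ Finset.Icc 1 k, β (2 * i) * (v (n - ℓ) / (α + 1)) * v (n - 2 * i) =
        (∑ i ∈ Finset.Icc 1 k, β (2 * i) * (x (n - 2 * i) - 1)) * (v (n - ℓ) / (α + 1)) := by
      rw [Finset.sum_mul]
      refine Finset.sum_congr rfl fun i hi => ?_
      rw [hv, parityTwist, parityTwist,
        if_pos (c := Even (n - 2 * i)) ((even_sub_two_mul_iff (hin i hi)).2 h)]
      ring
    rw [hs, ← Finset.sum_mul, ← hB, hvn, hvl]
    set s := ∑ i ∈ Finset.Icc 1 k, β (2 * i) * (x (n - 2 * i) - 1)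
    field_simp
    linarith
  · refine ⟨fun i => 1 / v (n - 2 * i), fun i hi => Or.inr rfl, ?_⟩
    have hvl : v (n - ℓ) = x (n - ℓ) - 1 := by
      rw [hv, parityTwist, if_pos ((even_sub_odd_iff hℓ hln).2 h)]
    have hvn : v n = (α + 1) / (x n - 1) := by rw [hv, parityTwist, if_neg h]
    have hvi : ∀ i ∈ Finset.Icc 1 k, v (n - 2 * i) = (α + 1) / (x (n - 2 * i) - 1) := fun i hi => by
      rw [hv, parityTwist, if_neg (by rw [even_sub_two_mul_iff (hin i hi)]; exact h)]
    have hs1 : ∑ i ∈ Finset.Icc 1 k, β (2 * i) * (1 / v (n - 2 * i)) =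
        (∑ i ∈ Finset.Icc 1 k, β (2 * i) * (x (n - 2 * i) - 1)) / (α + 1) := by
      rw [Finset.sum_div]
      refine Finset.sum_congr rfl fun i hi => ?_
      rw [hvi i hi, one_div_div]
      ring
    have hs2 : ∑ i ∈ Finset.Icc 1 k, β (2 * i) * (1 / v (n - 2 * i)) * v (n - 2 * i) = A + 1 := by
      rw [hB]
      refine Finset.sum_congr rfl fun i hi => ?_
      have := hxi i hi
      rw [hvi i hi]
      field_simp
    rw [hs1, hs2, hvn, hvl]
    set s := ∑ i ∈ Finset.Icc 1 k, β (2 * i) * (x (n - 2 * i) - 1)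
    field_simp
    linarith

/-- If `z` is the mean of `t` and the `y i` with weights proportional to `1` and `β (2 * i) * b i`,
and all averaged values are at most `S`, then the distance of `z` from `S` is at least a fixed
fraction of the distance of each averaged value from `S`. -/
lemma weight_mul_le_of_mean {b y : ℕ → ℝ} {z t S p P : ℝ} (hp : 0 < p)
    (hβ : ∀ i ∈ Finset.Icc 1 k, 0 ≤ β (2 * i)) (hb : ∀ i ∈ Finset.Icc 1 k, p ≤ b i ∧ b i ≤ P)
    (he : (1 + ∑ i ∈ Finset.Icc 1 k, β (2 * i) * b i) * z =
      t + ∑ i ∈ Finset.Icc 1 k, β (2 * i) * b i * y i)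
    (ht : t ≤ S) (hy : ∀ i ∈ Finset.Icc 1 k, 0 < β (2 * i) → y i ≤ S) :
    z ≤ S ∧ S - t ≤ (1 + (∑ i ∈ Finset.Icc 1 k, β (2 * i)) * P) * (S - z) ∧
      ∀ i ∈ Finset.Icc 1 k, 0 < β (2 * i) →
        β (2 * i) * p * (S - y i) ≤ (1 + (∑ i ∈ Finset.Icc 1 k, β (2 * i)) * P) * (S - z) := by
  have hb0 : ∀ i ∈ Finset.Icc 1 k, 0 ≤ β (2 * i) * b i := fun i hi =>
    mul_nonneg (hβ i hi) (hp.le.trans (hb i hi).1)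
  have hterm : ∀ i ∈ Finset.Icc 1 k, 0 ≤ β (2 * i) * b i * (S - y i) := fun i hi => by
    rcases (hβ i hi).eq_or_lt with h | h
    · rw [← h]
      simp
    · exact mul_nonneg (hb0 i hi) (sub_nonneg.2 (hy i hi h))
  have hW : 0 ≤ ∑ i ∈ Finset.Icc 1 k, β (2 * i) * b i := Finset.sum_nonneg hb0
  have hWP : ∑ i ∈ Finset.Icc 1 k, β (2 * i) * b i ≤ (∑ i ∈ Finset.Icc 1 k, β (2 * i)) * P := by
    rw [Finset.sum_mul]
    exact Finset.sum_le_sum fun i hi => mul_le_mul_of_nonneg_left (hb i hi).2 (hβ i hi)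
  have hS : (1 + ∑ i ∈ Finset.Icc 1 k, β (2 * i) * b i) * (S - z) =
      (S - t) + ∑ i ∈ Finset.Icc 1 k, β (2 * i) * b i * (S - y i) := by
    simp only [mul_sub _ S, Finset.sum_sub_distrib, ← Finset.sum_mul]
    rw [he]
    ring
  have hT := Finset.sum_nonneg hterm
  have hz : 0 ≤ S - z := by
    refine nonneg_of_mul_nonneg_right ?_
      (show 0 < 1 + ∑ i ∈ Finset.Icc 1 k, β (2 * i) * b i by linarith)
    rw [hS]
    linarith
  have hle := mul_le_mul_of_nonneg_right (add_le_add_right hWP 1) hz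
  refine ⟨sub_nonneg.1 hz, by linarith, fun i hi hpos => ?_⟩
  have h1 := Finset.single_le_sum hterm hi
  have h2 : β (2 * i) * p * (S - y i) ≤ β (2 * i) * b i * (S - y i) :=
    mul_le_mul_of_nonneg_right (mul_le_mul_of_nonneg_left (hb i hi).1 hpos.le)
      (sub_nonneg.2 (hy i hi hpos))
  linarith

lemma ge_of_mean {b y : ℕ → ℝ} {z t s p : ℝ} (hp : 0 < p)
    (hβ : ∀ i ∈ Finset.Icc 1 k, 0 ≤ β (2 * i)) (hb : ∀ i ∈ Finset.Icc 1 k, p ≤ b i)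
    (he : (1 + ∑ i ∈ Finset.Icc 1 k, β (2 * i) * b i) * z =
      t + ∑ i ∈ Finset.Icc 1 k, β (2 * i) * b i * y i)
    (ht : s ≤ t) (hy : ∀ i ∈ Finset.Icc 1 k, 0 < β (2 * i) → s ≤ y i) : s ≤ z := by
  obtain ⟨P, hP⟩ := exists_ge_of_lt b (k + 1)
  refine neg_le_neg_iff.1 (weight_mul_le_of_mean (b := b) (y := fun i => - y i) (z := -z) (t := -t)
    (P := P) hp hβ (fun i hi => ⟨hb i hi, hP i ?_⟩) ?_ (neg_le_neg ht)
    fun i hi h => neg_le_neg (hy i hi h)).1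
  · have := (Finset.mem_Icc.1 hi).2
    omega
  · simp only [mul_neg, Finset.sum_neg_distrib]
    linarith

theorem IsPositiveSolution.tendsto_periodic (hℓ : Odd ℓ) (hα : 0 ≤ α) (hA : 0 ≤ A)
    (hβ : ∀ i ∈ Finset.Icc 1 k, 0 ≤ β (2 * i)) (hB : A + 1 = ∑ i ∈ Finset.Icc 1 k, β (2 * i))
    (hx : IsPositiveSolution k ℓ α A β x) :
    ∃ y : ℕ → ℝ, IsPositiveSolution k ℓ α A β y ∧
      Function.Periodic y (2 * delayGcd k ℓ β) ∧ Tendsto (fun n => x n - y n) atTop (𝓝 0) := by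
  have hγ : 0 < α + 1 := by linarith
  have hB0 : 0 ≤ ∑ i ∈ Finset.Icc 1 k, β (2 * i) := Finset.sum_nonneg hβ
  set K := max (2 * k) ℓ with hK
  have hℓK : ℓ ≤ K := le_max_right _ _
  have hiK : ∀ i ∈ Finset.Icc 1 k, 0 < 2 * i ∧ 2 * i ≤ K := fun i hi => two_mul_pos_le ℓ hi
  obtain ⟨N₁, hN₁⟩ := hx.eventually_ge hℓ.pos hα hA hβ one_pos le_rfl (by linarith)
  obtain ⟨N, hKN, hN⟩ : ∃ N, K ≤ N ∧ ∀ n, N ≤ n → 1 < x n := by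
    refine ⟨N₁ + K, Nat.le_add_left _ _, fun n hn => ?_⟩
    have he := hx.mul_eq hℓ.pos hα hA hβ (n := n) (by omega)
    have hs := le_sum_mul (x := x) (m := 1) (n := n) hβ fun i hi =>
      hN₁ _ (by have := (hiK i hi).2; omega)
    have hl := hN₁ (n - ℓ) (by omega)
    refine lt_of_mul_lt_mul_right ?_ (show 0 ≤ A + x (n - ℓ) by linarith)
    linarith
  set v := parityTwist (α + 1) (fun n => x n - 1) with hv
  have hvpos : ∀ n, N ≤ n → 0 < v n := fun n hn => parityTwist_pos hγ (sub_pos.2 (hN n hn))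
  obtain ⟨m, hm, hmv⟩ := exists_pos_le_of_lt v N (N + K) fun n hn _ => hvpos n hn
  obtain ⟨M₀, hM₀⟩ := exists_ge_of_lt v (N + K)
  set M := max M₀ m with hM
  have hM0 : 0 < M := lt_max_of_lt_right hm
  set p := min (m / (α + 1)) (1 / M) with hp
  set P := max (M / (α + 1)) (1 / m) with hP
  have hp0 : 0 < p := lt_min (by positivity) (by positivity)
  have hP0 : 0 < P := lt_max_of_lt_left (by positivity)
  have hweights : ∀ n, N + K ≤ n → (∀ d, 0 < d → d ≤ K → m ≤ v (n - d) ∧ v (n - d) ≤ M) →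
      ∃ b : ℕ → ℝ, (∀ i ∈ Finset.Icc 1 k, p ≤ b i ∧ b i ≤ P) ∧
        (1 + ∑ i ∈ Finset.Icc 1 k, β (2 * i) * b i) * v n =
          v (n - ℓ) + ∑ i ∈ Finset.Icc 1 k, β (2 * i) * b i * v (n - 2 * i) := by
    intro n hn h
    obtain ⟨b, hb, he⟩ := exists_weights_parityTwist hℓ hα hA hβ hB hx hv (n := n) (by omega)
      fun d hd => hN _ (by omega)
    refine ⟨b, fun i hi => ?_, he⟩
    rcases hb i hi with h1 | h1
    · have h2 := h ℓ hℓ.pos hℓK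
      rw [h1]
      exact ⟨(min_le_left _ _).trans (div_le_div_of_nonneg_right h2.1 hγ.le),
        (div_le_div_of_nonneg_right h2.2 hγ.le).trans (le_max_left _ _)⟩
    · have h2 := h _ (hiK i hi).1 (hiK i hi).2
      rw [h1]
      exact ⟨(min_le_right _ _).trans (one_div_le_one_div_of_le (hm.trans_le h2.1) h2.2),
        (one_div_le_one_div_of_le hm h2.1).trans (le_max_right _ _)⟩
  have hab : ∀ n, N ≤ n → m ≤ v n ∧ v n ≤ M := by
    refine window_induction (K := K)
      (fun n h1 h2 => ⟨hmv n h1 h2, (hM₀ n h2).trans (le_max_left _ _)⟩) fun n hn ih => ?_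
    obtain ⟨b, hb, he⟩ := hweights n hn ih
    have hl := ih ℓ hℓ.pos hℓK
    have hi := fun i hi => ih _ (hiK i hi).1 (hiK i hi).2
    exact ⟨ge_of_mean hp0 hβ (fun i hi => (hb i hi).1) he hl.1 fun i h _ => (hi i h).1,
      (weight_mul_le_of_mean hp0 hβ hb he hl.2 fun i h _ => (hi i h).2).1⟩
  have hweights' := fun n (hn : N + K ≤ n) => hweights n hn fun d _ hd => hab _ (by omega)
  set W := 1 + (∑ i ∈ Finset.Icc 1 k, β (2 * i)) * P with hW
  have hW0 : 0 < W := by positivity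
  have hne : ∀ i, 2 * i ≠ ℓ := fun i h => by
    have := Nat.not_even_iff_odd.2 hℓ
    exact this (h ▸ even_two_mul i)
  have hlD : ℓ ∈ numeratorDelays k ℓ β := mem_numeratorDelays.2 (Or.inl rfl)
  have hiD : ∀ i ∈ Finset.Icc 1 k, 0 < β (2 * i) → 2 * i ∈ numeratorDelays k ℓ β := fun i hi h =>
    mem_numeratorDelays.2 (Or.inr ⟨i, hi, h, rfl⟩)
  have hg : delayGcd k ℓ β ≠ 0 := (odd_delayGcd hℓ).pos.ne'
  obtain ⟨w, hwm, hw, hvw⟩ := exists_periodic_tendsto_sub hg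
    (exists_tendsto_residue_of_mean (D := numeratorDelays k ℓ β) (K := K) (N := N) hg
      (fun d hd => by
        refine ⟨?_, ?_, delayGcd_dvd hd⟩
        all_goals obtain rfl | ⟨i, hi, -, rfl⟩ := mem_numeratorDelays.1 hd
        exacts [hℓ.pos, (hiK i hi).1, hℓK, (hiK i hi).2])
      exists_mem_closure_numeratorDelays
      (c := fun d => if d = ℓ then 1 / W else β d * p / W)
      (fun d hd => by
        obtain rfl | ⟨i, hi, hpos, rfl⟩ := mem_numeratorDelays.1 hd
        · rw [if_pos rfl]
          positivity
        · rw [if_neg (hne i)]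
          positivity)
      hab
      (fun n hn S hS d hd => by
        obtain ⟨b, hb, he⟩ := hweights' n hn
        obtain ⟨-, h1, h2⟩ := weight_mul_le_of_mean hp0 hβ hb he (hS ℓ hlD)
          fun i hi h => hS _ (hiD i hi h)
        obtain rfl | ⟨i, hi, hpos, rfl⟩ := mem_numeratorDelays.1 hd
        · rw [if_pos rfl, one_div_mul_eq_div, div_le_iff₀ hW0, mul_comm]
          exact h1
        · rw [if_neg (hne i), div_mul_eq_mul_div, div_le_iff₀ hW0, mul_comm (S - v n)]
          exact h2 i hi hpos)
      (fun n hn s hs => by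
        obtain ⟨b, hb, he⟩ := hweights' n hn
        exact ge_of_mean hp0 hβ (fun i hi => (hb i hi).1) he (hs ℓ hlD)
          fun i hi h => hs _ (hiD i hi h)))
  have hw0 : ∀ n, 0 < w n := fun n => hm.trans_le (hwm n)
  refine ⟨fun n => 1 + parityTwist (α + 1) w n,
    isPositiveSolution_one_add_parityTwist hℓ hα hA hβ hB hw0 hw,
    periodic_one_add_parityTwist hw, ?_⟩
  have hxv : ∀ n, x n = 1 + parityTwist (α + 1) v n := fun n => by
    rw [hv, parityTwist_parityTwist hγ.ne']
    ring
  -- `t ↦ (α + 1) / t` is Lipschitz on values bounded below by `m`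
  have hbound : ∀ᶠ n in atTop, |x n - (1 + parityTwist (α + 1) w n)| ≤
      (1 + (α + 1) / (m * m)) * |v n - w n| := by
    filter_upwards [eventually_ge_atTop N] with n hn
    have h0 := abs_nonneg (v n - w n)
    have h1 : 0 ≤ (α + 1) / (m * m) := by positivity
    rw [hxv, add_sub_add_left_eq_sub, parityTwist, parityTwist]
    by_cases h : Even n
    · rw [if_pos h, if_pos h]
      linarith [mul_nonneg h1 h0]
    · rw [if_neg h, if_neg h]
      have hvn := hvpos n hn
      have hwn := hw0 n
      have h2 : (α + 1) / v n - (α + 1) / w n = (α + 1) / (v n * w n) * (w n - v n) := by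
        field_simp
      have h3 : (α + 1) / (v n * w n) ≤ (α + 1) / (m * m) :=
        div_le_div_of_nonneg_left hγ.le (by positivity)
          (mul_le_mul (hab n hn).1 (hwm n) hm.le hvn.le)
      rw [h2, abs_mul, abs_of_pos (by positivity), abs_sub_comm (w n)]
      linarith [mul_le_mul_of_nonneg_right h3 h0]
  refine squeeze_zero_norm' hbound ?_
  simpa using hvw.abs.const_mul (1 + (α + 1) / (m * m))

/-- With `w = 2 * (α + 1)` at the multiples of `g` and `w = 1` elsewhere, the solution takes its
maximum exactly at the multiples of `2 * g`. -/
theorem exists_solution_hasPrimePeriod (hℓ : Odd ℓ) (hα : 0 ≤ α) (hA : 0 ≤ A)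
    (hβ : ∀ i ∈ Finset.Icc 1 k, 0 ≤ β (2 * i)) (hB : A + 1 = ∑ i ∈ Finset.Icc 1 k, β (2 * i)) :
    ∃ y : ℕ → ℝ, IsPositiveSolution k ℓ α A β y ∧
      HasPrimePeriod y (2 * delayGcd k ℓ β) := by
  have hγ : 0 < α + 1 := by linarith
  have hgo : Odd (delayGcd k ℓ β) := odd_delayGcd hℓ
  set w : ℕ → ℝ := fun n => if delayGcd k ℓ β ∣ n then 2 * (α + 1) else 1 with hw
  have hw0 : ∀ n, 0 < w n := fun n => by
    simp only [hw]
    split_ifs <;> positivity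
  have hwp : Function.Periodic w (delayGcd k ℓ β) := fun n => by
    simp only [hw, Nat.dvd_add_self_right]
  have hper := periodic_one_add_parityTwist (γ := α + 1) hwp
  refine ⟨_, isPositiveSolution_one_add_parityTwist hℓ hα hA hβ hB hw0 hwp,
    by have := hgo.pos; omega, hper, fun q hq hqper => ?_⟩
  have h0 := hqper 0
  have h00 : parityTwist (α + 1) w 0 = 2 * (α + 1) := by simp [parityTwist, hw]
  simp only [zero_add, h00, add_right_inj] at h0
  suffices h : Even q ∧ delayGcd k ℓ β ∣ q from
    Nat.le_of_dvd hq (Nat.Coprime.mul_dvd_of_dvd_of_dvd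
      (Nat.coprime_two_left.2 hgo) (even_iff_two_dvd.1 h.1) h.2)
  by_contra hcon
  simp only [parityTwist, hw] at h0
  split_ifs at h0 with h1 h2 h2
  · exact hcon ⟨h1, h2⟩
  · linarith
  · rw [div_eq_iff (by positivity)] at h0
    nlinarith
  · linarith

end Critical

theorem theorem3 (k ℓ : ℕ) (hℓ : Odd ℓ) (α A : ℝ) (β : ℕ → ℝ)
    (hα : 0 ≤ α) (hA : 0 ≤ A) (hβ : ∀ i ∈ Finset.Icc 1 k, 0 ≤ β (2 * i)) :
    (∑ i ∈ Finset.Icc 1 k, β (2 * i) < A + 1 →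
      ∀ x : ℕ → ℝ, IsPositiveSolution k ℓ α A β x →
        ∃ c : ℝ, IsEquilibrium k ℓ α A β c ∧ Tendsto x atTop (𝓝 c)) ∧
    (A + 1 = ∑ i ∈ Finset.Icc 1 k, β (2 * i) →
      (∀ x : ℕ → ℝ, IsPositiveSolution k ℓ α A β x →
        ∃ y : ℕ → ℝ, IsPositiveSolution k ℓ α A β y ∧
          Function.Periodic y (2 * delayGcd k ℓ β) ∧
          Tendsto (fun n => x n - y n) atTop (𝓝 0)) ∧
      ∃ y : ℕ → ℝ, IsPositiveSolution k ℓ α A β y ∧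
        HasPrimePeriod y (2 * delayGcd k ℓ β)) ∧
    (A + 1 < ∑ i ∈ Finset.Icc 1 k, β (2 * i) →
      ∃ x : ℕ → ℝ, IsPositiveSolution k ℓ α A β x ∧ ¬ BddAbove (Set.range x)) :=
  ⟨fun hB _ hx => hx.tendsto_equilibrium hℓ.pos hα hA hβ hB,
    fun hB => ⟨fun _ hx => hx.tendsto_periodic hℓ hα hA hβ hB,
      exists_solution_hasPrimePeriod hℓ hα hA hβ hB⟩,
    fun hB => exists_unbounded_solution hℓ hα hA hβ hB⟩
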